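/- Let $E_1,\dots,E_r$ and $Y$ be finite-dimensional real inner product spaces (for instance $\mathbb R^{n_i}$ and $\mathbb R^m$), let $\mathcal K^i\subseteq E_i$ be nonempty closed convex cones, $E=E_1\times\dots\times E_r$ with the product inner product, and $\mathcal K=\mathcal K^1\times\dots\times\mathcal K^r$. Let $\mathcal A:E\to Y$ be linear with adjoint $\mathcal A^\top$, and let $c\in E$. Write $C^*=\{s:\langle x,s\rangle\ge 0\ \forall x\in C\}$. For an affine subspace $\mathcal V$ of $E$, the feasibility problem $(\mathcal V,\mathcal K)$ is *strongly infeasible* if $\mathrm{dist}(\mathcal V,\mathcal K)>0$ (the distance being $+\infty$ if $\mathcal V=\emptyset$) and *weakly infeasible* if $\mathcal V\cap\mathcal K=\emptyset$ but $\mathrm{dist}(\mathcal V,\mathcal K)=0$. Let (D) be the problem $(c-\mathrm{range}\,\mathcal A^\top,\mathcal K)$, and let $(\mathrm P_{\rm feas})$ be $\inf\{\langle c,x\rangle:\mathcal Ax=0,\ x\in\mathcal K^*\}$, with value $\theta\in[-\infty,\infty]$. A sequence $d_1,\dots,d_\ell$ ($\ell\ge 0$) consists of *reducing directions for $(\mathrm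 P_{\rm feas})$* if $d_i\in\mathrm{range}\,\mathcal A^\top\cap\mathcal F_i^*$ for all $i\le\ell$, where $\mathcal F_i=\mathcal K^*\cap\{d_1\}^\perp\cap\dots\cap\{d_{i-1}\}^\perp$. It *restores strong duality* if $\theta$ equals the value of the problem $\sup\{0: c-\mathcal A^\top y\in\mathcal F_{\ell+1}^*,\ y\in Y\}$ (with $\sup\emptyset=-\infty$) and, if $\theta$ is finite, the latter is attained. $\mathrm{dist}_S(\mathrm P_{\rm feas})$ is the least $\ell$ for which some such sequence of length $\ell$ restores strong duality. For a nonempty closed convex cone $\mathcal C$, $\mathrm{dist}_{\rm poly}(\mathcal C)$ is the largest $\ell$ for which there is a chain $\mathcal G_0\subsetneq\mathcal G_1\subsetneq\dots\subsetneq\mathcal G_\ell$ of nonempty faces of $\mathcal C$ such that $\mathcal G_0$ is polyhedral and $\mathcal G_1,\dots,\mathcal G_\ell$ are not. **Theorem.** (i) (D) is not strongly infeasible if and only if there are (a) a sequence of reducing directions $d_1,\dots,d_\ell$ for $(\mathrm P_{\rm feas})$ that restores strong duality, with $\ell=\mathrm{dist}_S(\mathrm P_{\rm feas})$, and (b) a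 point $\hat y\in Y$ such that $c-\mathcal A^\top\hat y\in(\mathcal K^*\cap\{d_1\}^\perp\cap\dots\cap\{d_\ell\}^\perp)^*$. (ii) If (D) is not strongly infeasible, then there is an affine subspace $\mathcal V'\subseteq c-\mathrm{range}\,\mathcal A^\top$ such that $(\mathcal V',\mathcal K)$ is not strongly infeasible and $$\dim\mathcal V'\ \le\ \mathrm{dist}_S(\mathrm P_{\rm feas})\ \le\ \sum_{i=1}^r\mathrm{dist}_{\rm poly}\big((\mathcal K^i)^*\big);$$ moreover, if (D) is weakly infeasible, then $(\mathcal V',\mathcal K)$ is weakly infeasible. -/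

import Mathlib

open scoped ENNReal

noncomputable section

namespace ConicLP

/-- The closed convex cone `K 0 × ⋯ × K (r - 1)` in the Euclidean product of the spaces `E i`. -/
def prodCone {r : ℕ} {E : Fin r → Type*} [∀ i, NormedAddCommGroup (E i)]
    [∀ i, InnerProductSpace ℝ (E i)] (K : ∀ i, ProperCone ℝ (E i)) : ProperCone ℝ (PiLp 2 E) :=
  ⨅ i, (K i).comap (PiLp.proj 2 E i : PiLp 2 E →L[ℝ] E i)

section Feasibility

variable {E : Type*} [NormedAddCommGroup E] [InnerProductSpace ℝ E]

/-- The distance `inf {‖v - k‖ : v ∈ V, k ∈ K}` between two sets (`∞` if one of them is empty). -/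
def setDist (V K : Set E) : ℝ≥0∞ := ⨅ v ∈ V, ⨅ k ∈ K, edist v k

/-- The feasibility problem `(V, K)`, of finding a point of `V ∩ K`, is strongly infeasible. -/
def StronglyInfeasible (V K : Set E) : Prop := 0 < setDist V K

/-- The feasibility problem `(V, K)`, of finding a point of `V ∩ K`, is weakly infeasible. -/
def WeaklyInfeasible (V K : Set E) : Prop := V ∩ K = ∅ ∧ setDist V K = 0

end Feasibility

section Polyhedrality

variable {E : Type*} [NormedAddCommGroup E] [InnerProductSpace ℝ E]

/-- A cone is polyhedral if it is the intersection of finitely many half-spaces `⟪a, x⟫ ≥ 0`. -/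
def IsPolyhedral (C : PointedCone ℝ E) : Prop := C.DualFG (innerₗ E)

/-- `F 0 ⊊ F 1 ⊊ ⋯ ⊊ F ℓ` are faces of `K`, the first one is polyhedral and the others are not. -/
structure IsPolyhedralityChain (K : ProperCone ℝ E) {ℓ : ℕ}
    (F : Fin (ℓ + 1) → PointedCone ℝ E) : Prop where
  strictMono : StrictMono F
  isFaceOf : ∀ j, (F j).IsFaceOf K.toPointedCone
  polyhedral : IsPolyhedral (F 0)
  not_polyhedral : ∀ j, j ≠ 0 → ¬ IsPolyhedral (F j)

/-- The distance to polyhedrality of `K`: the number of faces, minus one, of a longest chain as in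
`IsPolyhedralityChain`. -/
def distPoly (K : ProperCone ℝ E) : ℕ∞ :=
  ⨆ (ℓ : ℕ) (F : Fin (ℓ + 1) → PointedCone ℝ E) (_ : IsPolyhedralityChain K F), (ℓ : ℕ∞)

end Polyhedrality

section Duality

variable {E Y : Type*} [NormedAddCommGroup E] [InnerProductSpace ℝ E] [FiniteDimensional ℝ E]
  [NormedAddCommGroup Y] [InnerProductSpace ℝ Y] [FiniteDimensional ℝ Y]

/-- The affine space `c - range Aᵀ` of the slacks `c - Aᵀ y`. -/
def slackSpace (A : E →ₗ[ℝ] Y) (c : E) : AffineSubspace ℝ E :=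
  AffineSubspace.mk' c (LinearMap.range A.adjoint)

/-- The optimal value of `inf {⟪c, x⟫ : A x = b, x ∈ C}`. -/
def primalValue (A : E →ₗ[ℝ] Y) (b : Y) (c : E) (C : Set E) : EReal :=
  ⨅ x ∈ {x : E | A x = b ∧ x ∈ C}, ((inner ℝ c x : ℝ) : EReal)

/-- The optimal value of `sup {⟪b, y⟫ : c - Aᵀ y ∈ C}`. -/
def dualValue (A : E →ₗ[ℝ] Y) (b : Y) (c : E) (C : Set E) : EReal :=
  ⨆ y ∈ {y : Y | c - A.adjoint y ∈ C}, ((inner ℝ b y : ℝ) : EReal)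

/-- The optimal value of `sup {⟪b, y⟫ : c - Aᵀ y ∈ C}` is attained. -/
def DualAttained (A : E →ₗ[ℝ] Y) (b : Y) (c : E) (C : Set E) : Prop :=
  ∃ y, c - A.adjoint y ∈ C ∧ ((inner ℝ b y : ℝ) : EReal) = dualValue A b c C

/-- The face `C ∩ {d 0}ᗮ ∩ ⋯ ∩ {d (k - 1)}ᗮ` of `C` after the first `k` reduction steps. -/
def reducedFace (C : Set E) {ℓ : ℕ} (d : Fin ℓ → E) (k : ℕ) : Set E :=
  {x | x ∈ C ∧ ∀ j : Fin ℓ, (j : ℕ) < k → inner ℝ (d j) x = 0}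

/-- `d 0, …, d (ℓ - 1)` are successive reducing directions for the constraints `A x = 0`, `x ∈ C`:
each `d i` lies in `(ker A)ᗮ = range Aᵀ` and in the dual of the face reached before it.
(As the right-hand side is zero, the further condition on the product of `d i` with a solution of
the linear equations, `≤ 0`, is automatic.) -/
def IsReducingSequence (A : E →ₗ[ℝ] Y) (C : Set E) {ℓ : ℕ} (d : Fin ℓ → E) : Prop :=
  ∀ i : Fin ℓ, d i ∈ LinearMap.range A.adjoint ∧
    d i ∈ ProperCone.innerDual (reducedFace C d i)

/-- The dual cone of the face of `K*` that is reached after all the reduction steps. -/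
def reducedDualCone (K : ProperCone ℝ E) {ℓ : ℕ} (d : Fin ℓ → E) : ProperCone ℝ E :=
  ProperCone.innerDual (reducedFace (ProperCone.innerDual (K : Set E) : Set E) d ℓ)

/-- Reducing directions `d` for `(P) inf {⟪c, x⟫ : A x = 0, x ∈ K*}` restore strong duality: the
value of `(P)` is that of the dual problem of the reduced primal one, and the latter is attained
if the value is finite. -/
structure RestoresStrongDuality (A : E →ₗ[ℝ] Y) (c : E) (K : ProperCone ℝ E) {ℓ : ℕ}
    (d : Fin ℓ → E) : Prop where
  reducing : IsReducingSequence A (ProperCone.innerDual (K : Set E) : Set E) d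
  value_eq : primalValue A 0 c (ProperCone.innerDual (K : Set E) : Set E) =
    dualValue A 0 c (reducedDualCone K d : Set E)
  attained : ⊥ < primalValue A 0 c (ProperCone.innerDual (K : Set E) : Set E) →
    primalValue A 0 c (ProperCone.innerDual (K : Set E) : Set E) < ⊤ →
    DualAttained A 0 c (reducedDualCone K d : Set E)

/-- The distance to strong duality of `inf {⟪c, x⟫ : A x = 0, x ∈ K*}`: the minimal number of
reducing directions that restore strong duality (`∞` if there were none). -/
def distStrong (A : E →ₗ[ℝ] Y) (c : E) (K : ProperCone ℝ E) : ℕ∞ :=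
  ⨅ (ℓ : ℕ) (d : Fin ℓ → E) (_ : RestoresStrongDuality A c K d), (ℓ : ℕ∞)

end Duality

end ConicLP

end

/-! By separation, `c - range Aᵀ` has distance zero to `K` exactly when `c` is nonnegative on `K* ∩
ker A` (`not_stronglyInfeasible_mk'_iff`). The primal problem is homogeneous, so its value is then
`0`, and otherwise `-∞`; hence restoring strong duality means that the reduced dual is feasible
whenever the value is `0` (`restoresStrongDuality_iff`). Part (i) follows once a restoring sequence
exists.

Such a sequence comes from facial reduction on the product `K*`. A reducing direction that does not
vanish on some nonpolyhedral factor cuts that factor down to a proper face, which lowers the sum of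
the distances to polyhedrality. When no such direction is left, `range Aᵀ + F*` is closed
(`isClosed_sup_innerDual_prodCone`), and Farkas' lemma makes the reduced dual feasible. This bounds
the number of steps.

For (ii), take a slack `s` feasible for the reduced dual of a shortest restoring sequence, and `V' =
s + span d`. The points of `K*` orthogonal to all `d j` form the reduced face, on which `s` is
nonnegative, so the same separation criterion applies to `V'`. -/

namespace ConicLP

/-! ### Closedness of sums of cones -/

section ClosedSums

variable {E : Type*} [NormedAddCommGroup E] [InnerProductSpace ℝ E]

/-- A cone is stably closed if its sum with every linear subspace is closed. -/
def StablyClosed (D : PointedCone ℝ E) : Prop :=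
  ∀ N : Submodule ℝ E, IsClosed ((D ⊔ PointedCone.ofSubmodule N : PointedCone ℝ E) : Set E)

theorem StablyClosed.isClosed {D : PointedCone ℝ E} (h : StablyClosed D) :
    IsClosed (D : Set E) := by
  have := h ⊥
  have e : D ⊔ PointedCone.ofSubmodule (⊥ : Submodule ℝ E) = D := by
    rw [sup_eq_left]
    intro x hx
    rw [PointedCone.mem_ofSubmodule_iff, Submodule.mem_bot] at hx
    exact hx ▸ D.zero_mem
  rwa [e] at this

theorem StablyClosed.sup_ofSubmodule {D : PointedCone ℝ E} (h : StablyClosed D)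
    (N : Submodule ℝ E) : StablyClosed (D ⊔ PointedCone.ofSubmodule N) := by
  intro N'
  rw [sup_assoc, ← PointedCone.ofSubmodule_sup]
  exact h _

/-- The ray spanned by `v` is closed. -/
theorem isClosed_hull_singleton (v : E) :
    IsClosed ((PointedCone.hull ℝ {v} : PointedCone ℝ E) : Set E) := by
  rcases eq_or_ne v 0 with rfl | hv
  · simp [PointedCone.hull]
  have : ((PointedCone.hull ℝ {v} : PointedCone ℝ E) : Set E) = (· • v) '' Set.Ici (0 : ℝ) := by
    ext x
    simp only [SetLike.mem_coe, Submodule.mem_span_singleton, Set.mem_image, Set.mem_Ici]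
    constructor
    · rintro ⟨a, rfl⟩
      exact ⟨a, a.2, rfl⟩
    · rintro ⟨a, ha, rfl⟩
      exact ⟨⟨a, ha⟩, rfl⟩
  rw [this]
  exact (isClosedEmbedding_smul_left hv).isClosedMap _ isClosed_Ici

variable [FiniteDimensional ℝ E]

open scoped Pointwise in
/-- The sum of two closed cones is closed if only zero lies in one of them and in the negative
of the other. -/
theorem isClosed_sup_of_inter_neg {D₁ D₂ : PointedCone ℝ E} (h₁ : IsClosed (D₁ : Set E))
    (h₂ : IsClosed (D₂ : Set E)) (h : ∀ x ∈ D₂, -x ∈ D₁ → x = 0) :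
    IsClosed ((D₁ ⊔ D₂ : PointedCone ℝ E) : Set E) := by
  have hK : IsCompact ((D₂ : Set E) ∩ Metric.sphere 0 1) := (isCompact_sphere 0 1).inter_left h₂
  have hN : IsClosed (Neg.neg ⁻¹' (D₁ : Set E)) := h₁.preimage continuous_neg
  have hd : Disjoint ((D₂ : Set E) ∩ Metric.sphere 0 1) (Neg.neg ⁻¹' (D₁ : Set E)) := by
    rw [Set.disjoint_left]
    rintro x ⟨hx, hx1⟩ hx2
    have := h x hx hx2
    simp [this] at hx1
  obtain ⟨ε, hε, hlt⟩ := Metric.exists_pos_forall_lt_edist hK hN hd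
  -- The unit vectors of `D₂` stay at distance more than `ε` from `-D₁`. By scaling, a bounded sum
  -- has a bounded `D₂`-part, so `D₂` may be replaced by a compact piece.
  have key : ∀ a ∈ D₁, ∀ b ∈ D₂, (ε : ℝ) * ‖b‖ ≤ ‖a + b‖ := by
    intro a ha b hb
    rcases eq_or_ne b 0 with rfl | hb0
    · simp
    have hpos : 0 < ‖b‖ := norm_pos_iff.mpr hb0
    have e1 := hlt (‖b‖⁻¹ • b) ⟨D₂.smul_mem (inv_nonneg.mpr hpos.le) hb, by
      simp [norm_smul, hpos.ne']⟩ (-(‖b‖⁻¹ • a)) (by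
        simpa using D₁.smul_mem (inv_nonneg.mpr hpos.le) ha)
    rw [edist_nndist, ENNReal.coe_lt_coe, ← NNReal.coe_lt_coe, coe_nndist, dist_eq_norm,
      sub_neg_eq_add, ← smul_add, norm_smul, norm_inv, norm_norm, add_comm b a] at e1
    rw [mul_comm]
    rw [inv_mul_eq_div, lt_div_iff₀ hpos] at e1
    linarith
  rw [← isSeqClosed_iff_isClosed]
  intro u x hu hx
  obtain ⟨R, hR⟩ : ∃ R, ∀ n, ‖u n‖ ≤ R := by
    obtain ⟨R, hR⟩ := hx.norm.bddAbove_range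
    exact ⟨R, fun n => hR ⟨n, rfl⟩⟩
  have hcl : IsClosed ((D₁ : Set E) + ((D₂ : Set E) ∩ Metric.closedBall 0 (R / ε))) :=
    h₁.add_right_of_isCompact ((isCompact_closedBall 0 _).inter_left h₂)
  have hmem := hcl.mem_of_tendsto hx (Filter.Eventually.of_forall fun n => by
    obtain ⟨a, ha, b, hb, hab⟩ := Submodule.mem_sup.mp (hu n)
    refine Set.mem_add.mpr ⟨a, ha, b, ⟨hb, ?_⟩, hab⟩
    have e := (key a ha b hb).trans (hab ▸ hR n)
    rw [mem_closedBall_zero_iff, le_div_iff₀ (by exact_mod_cast hε)]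
    linarith)
  obtain ⟨a, ha, b, hb, hab⟩ := Set.mem_add.mp hmem
  exact Submodule.mem_sup.mpr ⟨a, ha, b, hb.1, hab⟩

theorem StablyClosed.bot : StablyClosed (⊥ : PointedCone ℝ E) := by
  intro N
  rw [bot_sup_eq]
  exact N.closed_of_finiteDimensional

/-- If `-v` already lies in `D + N`, adding the ray of `v` amounts to adding its whole line, which
`N` can absorb. Otherwise the ray meets `-(D + N)` only in zero. -/
theorem StablyClosed.sup_hull_singleton {D : PointedCone ℝ E} (h : StablyClosed D) (v : E) :
    StablyClosed (D ⊔ PointedCone.hull ℝ {v}) := by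
  intro N
  have hv : v ∈ PointedCone.hull ℝ {v} := Submodule.mem_span_singleton_self v
  by_cases hmem : -v ∈ D ⊔ PointedCone.ofSubmodule N
  · have e : D ⊔ PointedCone.hull ℝ {v} ⊔ PointedCone.ofSubmodule N =
        D ⊔ PointedCone.ofSubmodule (N ⊔ Submodule.span ℝ {v}) := by
      rw [PointedCone.ofSubmodule_sup]
      apply le_antisymm
      · refine sup_le (sup_le le_sup_left ?_) (le_sup_left.trans le_sup_right)
        exact (PointedCone.hull_le_span ℝ {v}).trans (le_sup_right.trans le_sup_right)
      · refine sup_le (le_sup_left.trans le_sup_left) (sup_le le_sup_right ?_)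
        intro x hx
        obtain ⟨a, rfl⟩ := Submodule.mem_span_singleton.mp hx
        have hpos : v ∈ D ⊔ PointedCone.hull ℝ {v} ⊔ PointedCone.ofSubmodule N :=
          (le_sup_right.trans le_sup_left : PointedCone.hull ℝ {v} ≤ _) hv
        have hneg : -v ∈ D ⊔ PointedCone.hull ℝ {v} ⊔ PointedCone.ofSubmodule N :=
          (sup_le_sup_right le_sup_left _ : D ⊔ PointedCone.ofSubmodule N ≤ _) hmem
        rcases le_total 0 a with ha | ha
        · exact PointedCone.smul_mem _ ha hpos
        · have := PointedCone.smul_mem _ (neg_nonneg.mpr ha) hneg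
          rwa [smul_neg, neg_smul, neg_neg] at this
    rw [e]
    exact h _
  · rw [sup_right_comm]
    refine isClosed_sup_of_inter_neg (h N) (isClosed_hull_singleton v) ?_
    intro x hx hx'
    obtain ⟨a, rfl⟩ := Submodule.mem_span_singleton.mp hx
    rcases eq_or_ne a 0 with rfl | ha
    · simp
    exfalso
    have hapos : (0 : ℝ) < a := lt_of_le_of_ne a.2 (fun e => ha (Subtype.ext e.symm))
    refine hmem (((D ⊔ PointedCone.ofSubmodule N).smul_mem_iff hapos).mp ?_)
    rw [smul_neg]
    exact hx'

/-- Finitely generated cones are stably closed. -/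
theorem StablyClosed.hull {s : Set E} (hs : s.Finite) : StablyClosed (PointedCone.hull ℝ s) := by
  induction s, hs using Set.Finite.induction_on with
  | empty => simpa [PointedCone.hull] using StablyClosed.bot
  | @insert a s _ _ ih =>
    rw [PointedCone.hull, Set.insert_eq, Submodule.span_union, sup_comm]
    exact ih.sup_hull_singleton a

/-- The sum of a stably closed cone `D₁` and of a closed cone `D₂` is closed if every vector of
`D₂ ∩ -D₁` belongs to the lineality space of `D₂`. -/
theorem StablyClosed.isClosed_sup {D₁ D₂ : PointedCone ℝ E} (h₁ : StablyClosed D₁)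
    (h₂ : IsClosed (D₂ : Set E)) (h : ∀ x ∈ D₂, -x ∈ D₁ → -x ∈ D₂) :
    IsClosed ((D₁ ⊔ D₂ : PointedCone ℝ E) : Set E) := by
  -- `D₁` absorbs the lineality space of `D₂` by stability; what remains of `D₂` lies in `Nᗮ`, and
  -- there the hypothesis leaves only zero.
  set N := D₂.lineal with hN
  have hdec : D₂ = PointedCone.ofSubmodule N ⊔ (D₂ ⊓ PointedCone.ofSubmodule Nᗮ) := by
    apply le_antisymm
    · intro x hx
      obtain ⟨n, hn, m, hm, rfl⟩ := N.exists_add_mem_mem_orthogonal x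
      refine Submodule.add_mem_sup hn ⟨?_, hm⟩
      have := D₂.add_mem hx (PointedCone.mem_lineal.mp hn).2
      simpa using this
    · exact sup_le (PointedCone.lineal_le D₂) inf_le_left
  rw [hdec, ← sup_assoc]
  refine isClosed_sup_of_inter_neg (h₁ N) (h₂.inter Nᗮ.closed_of_finiteDimensional) ?_
  rintro x ⟨hx, hxo⟩ hx'
  obtain ⟨a, ha, n, hn, han⟩ := Submodule.mem_sup.mp hx'
  have hn' := PointedCone.mem_lineal.mp hn
  have ea : -(x + n) = a := by rw [neg_add, ← han]; abel
  have hxn : x + n ∈ D₂ := D₂.add_mem hx hn'.1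
  have hneg : -(x + n) ∈ D₂ := h _ hxn (by rw [ea]; exact ha)
  have hxN : x + n ∈ N := PointedCone.mem_lineal.mpr ⟨hxn, hneg⟩
  have hxN' : x ∈ N := by simpa using N.sub_mem hxN hn
  exact inner_self_eq_zero.mp (Submodule.inner_right_of_mem_orthogonal hxN' hxo)

end ClosedSums

open ProperCone (innerDual)

/-! ### Duals of polyhedral cones -/

theorem isPolyhedral_iff {E : Type*} [NormedAddCommGroup E] [InnerProductSpace ℝ E]
    {C : PointedCone ℝ E} :
    IsPolyhedral C ↔ ∃ s : Finset E, ∀ x, x ∈ C ↔ ∀ a ∈ s, 0 ≤ inner ℝ a x := by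
  constructor
  · rintro ⟨s, rfl⟩
    exact ⟨s, fun x => Iff.rfl⟩
  · rintro ⟨s, hs⟩
    exact ⟨s, by ext x; exact (hs x).symm⟩

/-- The dual of a polyhedral cone is finitely generated. -/
theorem IsPolyhedral.exists_innerDual_eq_hull {E : Type*} [NormedAddCommGroup E]
    [InnerProductSpace ℝ E] [FiniteDimensional ℝ E] {C : PointedCone ℝ E} (h : IsPolyhedral C) :
    ∃ s : Finset E, (innerDual (C : Set E)).toPointedCone = PointedCone.hull ℝ (s : Set E) := by
  obtain ⟨s, rfl⟩ := h
  refine ⟨s, ?_⟩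
  let D : ProperCone ℝ E := ⟨PointedCone.hull ℝ (s : Set E),
    (StablyClosed.hull s.finite_toSet).isClosed⟩
  have e : innerDual (PointedCone.dual (innerₗ E) (s : Set E) : Set E) = D := by
    rw [← ProperCone.innerDual_innerDual D, ← PointedCone.dual_hull]
    rfl
  rw [e]

/-! ### Products of cones and partial polyhedrality -/

section Product

variable {r : ℕ} {E : Fin r → Type*} [∀ i, NormedAddCommGroup (E i)]
  [∀ i, InnerProductSpace ℝ (E i)]

@[simp]
theorem mem_prodCone {K : ∀ i, ProperCone ℝ (E i)} {x : PiLp 2 E} :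
    x ∈ prodCone K ↔ ∀ i, x i ∈ K i := by
  simp [prodCone]

theorem single_mem_prodCone {K : ∀ i, ProperCone ℝ (E i)} {i : Fin r} {x : E i} (hx : x ∈ K i) :
    PiLp.single 2 i x ∈ prodCone K := by
  rw [mem_prodCone]
  intro j
  rcases eq_or_ne j i with rfl | h
  · simpa using hx
  · simp [h]

theorem inner_single_right (i : Fin r) (d : PiLp 2 E) (x : E i) :
    inner ℝ d (PiLp.single 2 i x) = inner ℝ (d i) x := by
  rw [PiLp.inner_apply, Finset.sum_eq_single i]
  · simp
  · intro j _ h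
    simp [h]
  · simp

variable [∀ i, FiniteDimensional ℝ (E i)]

/-- The dual of a product of cones is the product of the duals. -/
theorem innerDual_prodCone (K : ∀ i, ProperCone ℝ (E i)) :
    innerDual (prodCone K : Set (PiLp 2 E)) = prodCone fun i => innerDual (K i : Set (E i)) := by
  ext s
  simp only [ProperCone.mem_innerDual, mem_prodCone, SetLike.mem_coe]
  constructor
  · intro h i x hx
    have := h (single_mem_prodCone hx |> mem_prodCone.mp)
    rwa [real_inner_comm, inner_single_right, real_inner_comm] at this
  · intro h x hx
    rw [PiLp.inner_apply]
    exact Finset.sum_nonneg fun i _ => h i (hx i)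

/-- The sum of a linear subspace and of the dual of a product of closed cones is closed if the
vectors common to both vanish on all the nonpolyhedral factors. -/
theorem isClosed_sup_innerDual_prodCone (R : Submodule ℝ (PiLp 2 E))
    (C : ∀ i, ProperCone ℝ (E i))
    (h : ∀ d ∈ R, d ∈ innerDual (prodCone C : Set (PiLp 2 E)) →
      ∀ i, ¬ IsPolyhedral (C i).toPointedCone → ∀ x ∈ C i, inner ℝ (d i) x = 0) :
    IsClosed ((PointedCone.ofSubmodule R ⊔
      (innerDual (prodCone C : Set (PiLp 2 E))).toPointedCone :
        PointedCone ℝ (PiLp 2 E)) : Set (PiLp 2 E)) := by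
  classical
  have hS : ∀ i, ∃ s : Finset (E i), IsPolyhedral (C i).toPointedCone →
      (innerDual (C i : Set (E i))).toPointedCone = PointedCone.hull ℝ (s : Set (E i)) := by
    intro i
    by_cases hi : IsPolyhedral (C i).toPointedCone
    · obtain ⟨s, hs⟩ := hi.exists_innerDual_eq_hull
      exact ⟨s, fun _ => hs⟩
    · exact ⟨∅, fun h => absurd h hi⟩
  choose S hS using hS
  let T : Set (PiLp 2 E) := ⋃ i, ⋃ _ : IsPolyhedral (C i).toPointedCone,
    PiLp.single 2 i '' (S i : Set (E i))
  have hT : T.Finite := Set.finite_iUnion fun i => Set.finite_iUnion fun _ =>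
    (S i).finite_toSet.image _
  -- The dual cone splits as `P + Q`: the finitely generated part `P`, which can be added to `R`
  -- stably, and the merely closed part `Q`.
  let P : ProperCone ℝ (PiLp 2 E) := prodCone fun i =>
    if IsPolyhedral (C i).toPointedCone then innerDual (C i : Set (E i)) else ⊥
  let Q : ProperCone ℝ (PiLp 2 E) := prodCone fun i =>
    if IsPolyhedral (C i).toPointedCone then ⊥ else innerDual (C i : Set (E i))
  have hPT : P.toPointedCone = PointedCone.hull ℝ T := by
    apply le_antisymm
    · intro x hx
      have hx := mem_prodCone.mp hx
      have hxs : x = ∑ i, PiLp.single 2 i (x i) := by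
        ext j
        rw [WithLp.ofLp_sum, Finset.sum_apply, Finset.sum_eq_single j]
        · simp
        · intro i _ hij
          simp [hij.symm]
        · simp
      rw [hxs]
      refine Submodule.sum_mem _ fun i _ => ?_
      have hxi := hx i
      split_ifs at hxi with hi
      · have hxi : x i ∈ (innerDual (C i : Set (E i))).toPointedCone := hxi
        rw [hS i hi] at hxi
        generalize x i = w at hxi
        induction hxi using Submodule.span_induction with
        | mem y hy => exact Submodule.subset_span (Set.mem_iUnion₂.mpr ⟨i, hi, y, hy, rfl⟩)
        | zero => rw [(PiLp.single_eq_zero_iff 2 i).mpr rfl]; exact zero_mem _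
        | add y z _ _ hy hz => rw [PiLp.single_add]; exact add_mem hy hz
        | smul a y _ hy =>
          have e : PiLp.single 2 i (a • y) = a • (PiLp.single 2 i y : PiLp 2 E) := by
            ext j
            rcases eq_or_ne j i with rfl | h
            · simp
            · simp [h]
          rw [e]
          exact Submodule.smul_mem _ a hy
      · rw [(PiLp.single_eq_zero_iff 2 i).mpr hxi]
        exact zero_mem _
    · refine Submodule.span_le.mpr ?_
      intro x hx
      simp only [T, Set.mem_iUnion, Set.mem_image] at hx
      obtain ⟨i, hi, y, hy, rfl⟩ := hx
      refine single_mem_prodCone ?_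
      rw [if_pos hi]
      change y ∈ (innerDual (C i : Set (E i))).toPointedCone
      rw [hS i hi]
      exact Submodule.subset_span hy
  have hsum : (innerDual (prodCone C : Set (PiLp 2 E))).toPointedCone =
      P.toPointedCone ⊔ Q.toPointedCone := by
    rw [innerDual_prodCone]
    apply le_antisymm
    · intro x hx
      have hx := mem_prodCone.mp hx
      refine Submodule.mem_sup.mpr ⟨
        WithLp.toLp 2 fun i => if IsPolyhedral (C i).toPointedCone then x i else 0,
        mem_prodCone.mpr fun i => ?_,
        WithLp.toLp 2 fun i => if IsPolyhedral (C i).toPointedCone then 0 else x i,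
        mem_prodCone.mpr fun i => ?_, ?_⟩
      · dsimp only
        split_ifs
        · exact hx i
        · rfl
      · dsimp only
        split_ifs
        · rfl
        · exact hx i
      · ext i
        by_cases hi : IsPolyhedral (C i).toPointedCone <;> simp [hi]
    · refine sup_le ?_ ?_
      · intro x hx
        refine mem_prodCone.mpr fun i => ?_
        have := mem_prodCone.mp hx i
        split_ifs at this with hi
        · exact this
        · rw [show x i = 0 from this]
          exact zero_mem _
      · intro x hx
        refine mem_prodCone.mpr fun i => ?_
        have := mem_prodCone.mp hx i
        split_ifs at this with hi
        · rw [show x i = 0 from this]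
          exact zero_mem _
        · exact this
  rw [hsum, ← sup_assoc]
  refine StablyClosed.isClosed_sup ?_ Q.isClosed ?_
  · rw [sup_comm, hPT]
    exact (StablyClosed.hull hT).sup_ofSubmodule R
  · intro x hx hx'
    obtain ⟨ρ, hρ, p, hp, hρp⟩ := Submodule.mem_sup.mp hx'
    -- `-ρ = p + x` is common to `R` and the dual cone, so it vanishes on the nonpolyhedral factors.
    -- There `p` is zero, so `x` vanishes on them as well, and `-x` lies in `Q`.
    have hd : -ρ ∈ innerDual (prodCone C : Set (PiLp 2 E)) := by
      have e : -ρ = p + x := by rw [← neg_neg x, ← hρp]; abel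
      change -ρ ∈ (innerDual (prodCone C : Set (PiLp 2 E))).toPointedCone
      rw [hsum, e]
      exact Submodule.add_mem_sup hp hx
    have hρx : ∀ i, -ρ i = p i + x i := fun i => by
      have e : -ρ = p + x := by rw [← neg_neg x, ← hρp]; abel
      simpa using congrArg (fun v : PiLp 2 E => v i) e
    refine mem_prodCone.mpr fun i => ?_
    have hxi := mem_prodCone.mp hx i
    have hpi := mem_prodCone.mp hp i
    split_ifs at hxi hpi ⊢ with hi
    · exact neg_eq_zero.mpr hxi
    · have hpi : p i = 0 := hpi
      intro y hy
      have := h (-ρ) (R.neg_mem hρ) hd i hi y hy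
      rw [PiLp.neg_apply, hρx, hpi, zero_add, real_inner_comm] at this
      simp [this]

end Product

/-- If `range Aᵀ + C*` is closed, then every linear function that is nonnegative on
`{x ∈ C | A x = 0}` is nonnegative on `C` up to a vector of `range Aᵀ`. -/
theorem exists_sub_adjoint_mem_innerDual {E Y : Type*} [NormedAddCommGroup E]
    [InnerProductSpace ℝ E] [FiniteDimensional ℝ E] [NormedAddCommGroup Y]
    [InnerProductSpace ℝ Y] [FiniteDimensional ℝ Y] (A : E →ₗ[ℝ] Y) (C : ProperCone ℝ E) (z : E)
    (hcl : IsClosed ((PointedCone.ofSubmodule (LinearMap.range A.adjoint) ⊔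
      (innerDual (C : Set E)).toPointedCone : PointedCone ℝ E) : Set E))
    (hz : ∀ x ∈ C, A x = 0 → 0 ≤ inner ℝ z x) :
    ∃ y, z - A.adjoint y ∈ innerDual (C : Set E) := by
  let M : ProperCone ℝ E := ⟨_, hcl⟩
  by_cases hM : z ∈ M
  · obtain ⟨ρ, ⟨y, rfl⟩, s, hs, rfl⟩ := Submodule.mem_sup.mp hM
    exact ⟨y, by simpa using hs⟩
  · exfalso
    -- The separating `x` is nonnegative on the subspace `range Aᵀ`, hence in `ker A`, and
    -- nonnegative on `C*`, hence in `C` by biduality.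
    obtain ⟨x, hx, hzx⟩ := M.hyperplane_separation' hM
    have hle₁ : PointedCone.ofSubmodule (LinearMap.range A.adjoint) ≤ M.toPointedCone :=
      le_sup_left
    have hle₂ : (innerDual (C : Set E)).toPointedCone ≤ M.toPointedCone := le_sup_right
    have hA : A x = 0 := by
      have h1 : ∀ y, 0 ≤ inner ℝ y (A x) := fun y => by
        rw [← LinearMap.adjoint_inner_left]
        exact hx _ (hle₁ (LinearMap.mem_range_self _ y))
      have h2 := h1 (-A x)
      rw [inner_neg_left] at h2
      exact inner_self_eq_zero.mp (le_antisymm (by linarith) real_inner_self_nonneg)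
    have hxC : x ∈ C := by
      rw [← ProperCone.innerDual_innerDual C]
      intro s hs
      exact hx s (hle₂ hs)
    exact absurd (hz x hxC hA) (not_le.mpr hzx)

/-! ### Faces and distance to polyhedrality -/

section DistPoly

variable {E : Type*} [NormedAddCommGroup E] [InnerProductSpace ℝ E]

theorem IsPolyhedralityChain.le_distPoly {K : ProperCone ℝ E} {ℓ : ℕ}
    {F : Fin (ℓ + 1) → PointedCone ℝ E} (h : IsPolyhedralityChain K F) :
    (ℓ : ℕ∞) ≤ distPoly K :=
  le_iSup_of_le ℓ (le_iSup_of_le F (le_iSup_of_le h le_rfl))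

theorem IsPolyhedralityChain.of_isFaceOf {C K : ProperCone ℝ E}
    (hC : C.toPointedCone.IsFaceOf K.toPointedCone) {ℓ : ℕ} {F : Fin (ℓ + 1) → PointedCone ℝ E}
    (h : IsPolyhedralityChain C F) : IsPolyhedralityChain K F :=
  ⟨h.strictMono, fun j => (h.isFaceOf j).trans hC, h.polyhedral, h.not_polyhedral⟩

theorem distPoly_mono {C K : ProperCone ℝ E} (hC : C.toPointedCone.IsFaceOf K.toPointedCone) :
    distPoly C ≤ distPoly K :=
  iSup_le fun _ => iSup_le fun _ => iSup_le fun h => (h.of_isFaceOf hC).le_distPoly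

/-- A face contains every point of the cone that lies in its linear span. -/
theorem mem_of_isFaceOf_of_mem_span {F K : PointedCone ℝ E} (hF : F.IsFaceOf K) {x : E}
    (hxK : x ∈ K) (hx : x ∈ Submodule.span ℝ (F : Set E)) : x ∈ F := by
  -- Every vector of the span is a difference of two elements of `F`; the face property then applies
  -- to the sum `x + b`.
  have key : ∃ b ∈ F, x + b ∈ F := by
    clear hxK
    induction hx using Submodule.span_induction with
    | mem y hy => exact ⟨0, F.zero_mem, by simpa using hy⟩
    | zero => exact ⟨0, F.zero_mem, by simp⟩
    | add y z _ _ hy hz =>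
      obtain ⟨a, ha, hya⟩ := hy
      obtain ⟨b, hb, hzb⟩ := hz
      exact ⟨a + b, F.add_mem ha hb, by rw [add_add_add_comm]; exact F.add_mem hya hzb⟩
    | smul t y _ hy =>
      obtain ⟨a, ha, hya⟩ := hy
      rcases le_total 0 t with ht | ht
      · exact ⟨t • a, F.smul_mem ht ha, by rw [← smul_add]; exact F.smul_mem ht hya⟩
      · refine ⟨(-t) • (y + a), F.smul_mem (neg_nonneg.mpr ht) hya, ?_⟩
        have e : t • y + (-t) • (y + a) = (-t) • a := by module
        rw [e]
        exact F.smul_mem (neg_nonneg.mpr ht) ha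
  obtain ⟨b, hb, hxb⟩ := key
  exact hF.mem_of_add_mem_left hxK (hF.le hb) hxb

theorem IsPolyhedralityChain.snoc {C K : ProperCone ℝ E}
    (hC : C.toPointedCone.IsFaceOf K.toPointedCone) (hne : C.toPointedCone ≠ K.toPointedCone)
    (hK : ¬ IsPolyhedral K.toPointedCone) {ℓ : ℕ} {F : Fin (ℓ + 1) → PointedCone ℝ E}
    (h : IsPolyhedralityChain C F) :
    IsPolyhedralityChain K (Fin.snoc F K.toPointedCone : Fin (ℓ + 2) → PointedCone ℝ E) where
  strictMono := by
    refine Fin.strictMono_iff_lt_succ.mpr fun i => ?_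
    rw [Fin.snoc_castSucc]
    rcases Fin.eq_castSucc_or_eq_last i with ⟨j, rfl⟩ | rfl
    · rw [← Fin.castSucc_succ, Fin.snoc_castSucc]
      exact h.strictMono j.castSucc_lt_succ
    · rw [Fin.succ_last, Fin.snoc_last]
      exact lt_of_le_of_lt (h.isFaceOf _).le (lt_of_le_of_ne hC.le hne)
  isFaceOf j := by
    rcases Fin.eq_castSucc_or_eq_last j with ⟨j, rfl⟩ | rfl
    · rw [Fin.snoc_castSucc]
      exact (h.isFaceOf j).trans hC
    · rw [Fin.snoc_last]
  polyhedral := by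
    rw [← Fin.castSucc_zero, Fin.snoc_castSucc]
    exact h.polyhedral
  not_polyhedral j hj := by
    rcases Fin.eq_castSucc_or_eq_last j with ⟨j, rfl⟩ | rfl
    · rw [Fin.snoc_castSucc]
      exact h.not_polyhedral j fun e => hj (by rw [e, Fin.castSucc_zero])
    · rwa [Fin.snoc_last]

variable [FiniteDimensional ℝ E]

/-- A face is recovered from its span by intersecting with the cone, so spans of strictly increasing
faces have strictly increasing dimensions. The resulting finiteness of `distPoly` makes a drop by
one a strict inequality. -/
theorem IsPolyhedralityChain.length_le {K : ProperCone ℝ E} {ℓ : ℕ}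
    {F : Fin (ℓ + 1) → PointedCone ℝ E} (h : IsPolyhedralityChain K F) :
    ℓ ≤ Module.finrank ℝ E := by
  have hs : StrictMono fun j => Module.finrank ℝ (Submodule.span ℝ (F j : Set E)) := by
    intro i j hij
    refine Submodule.finrank_lt_finrank_of_lt
      (lt_of_le_of_ne (Submodule.span_mono (h.strictMono hij).le) fun e => ?_)
    refine (h.strictMono hij).not_ge fun x hx => ?_
    refine mem_of_isFaceOf_of_mem_span (h.isFaceOf i) ((h.isFaceOf j).le hx) ?_
    rw [e]
    exact Submodule.subset_span hx
  have h1 : ∀ j : Fin (ℓ + 1), (j : ℕ) ≤ Module.finrank ℝ (Submodule.span ℝ (F j : Set E)) := by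
    intro j
    induction j using Fin.induction with
    | zero => exact Nat.zero_le _
    | succ i ih => exact Nat.succ_le_of_lt (lt_of_le_of_lt ih (hs i.castSucc_lt_succ))
  exact (h1 (Fin.last ℓ)).trans (Submodule.finrank_le _)

theorem distPoly_ne_top (K : ProperCone ℝ E) : distPoly K ≠ ⊤ := by
  refine ne_top_of_le_ne_top (ENat.natCast_ne_top (Module.finrank ℝ E)) ?_
  exact iSup_le fun _ => iSup_le fun _ => iSup_le fun h => by exact_mod_cast h.length_le

/-- Linear subspaces are polyhedral. -/
theorem isPolyhedral_ofSubmodule (N : Submodule ℝ E) :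
    IsPolyhedral (PointedCone.ofSubmodule N) := by
  classical
  obtain ⟨s, hs⟩ := IsNoetherian.noetherian Nᗮ
  refine isPolyhedral_iff.mpr ⟨s ∪ s.image Neg.neg, fun x => ?_⟩
  rw [PointedCone.mem_ofSubmodule_iff]
  constructor
  · intro hx
    have h0 : ∀ a ∈ s, inner ℝ a x = 0 := fun a ha =>
      Submodule.inner_left_of_mem_orthogonal hx (hs ▸ Submodule.subset_span ha)
    intro a ha
    rcases Finset.mem_union.mp ha with ha | ha
    · exact (h0 a ha).ge
    · obtain ⟨b, hb, rfl⟩ := Finset.mem_image.mp ha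
      rw [inner_neg_left, h0 b hb, neg_zero]
  · intro h
    rw [← N.orthogonal_orthogonal, Submodule.mem_orthogonal, ← hs]
    intro u hu
    induction hu using Submodule.span_induction with
    | mem a ha =>
      have h1 := h a (Finset.mem_union_left _ ha)
      have h2 := h (-a) (Finset.mem_union_right _ (Finset.mem_image_of_mem _ ha))
      rw [inner_neg_left] at h2
      linarith
    | zero => exact inner_zero_left x
    | add a b _ _ ha hb => rw [inner_add_left, ha, hb, add_zero]
    | smul t a _ ha => rw [inner_smul_left, ha, mul_zero]

/-- Guarantees that the supremum in `distPoly` is over a nonempty family; an empty one would also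
give `0`, and lengthening chains would then prove nothing. -/
theorem isPolyhedralityChain_lineal (K : ProperCone ℝ E) :
    IsPolyhedralityChain K (ℓ := 0) fun _ => PointedCone.ofSubmodule K.toPointedCone.lineal where
  strictMono i j hij := absurd hij (by
    rw [Fin.fin_one_eq_zero i, Fin.fin_one_eq_zero j]
    exact lt_irrefl _)
  isFaceOf _ := PointedCone.IsFaceOf.lineal _
  polyhedral := isPolyhedral_ofSubmodule _
  not_polyhedral j hj := absurd (Fin.fin_one_eq_zero j) hj

/-- The distance to polyhedrality drops when a nonpolyhedral cone is replaced by a proper face. -/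
theorem distPoly_add_one_le {C K : ProperCone ℝ E}
    (hC : C.toPointedCone.IsFaceOf K.toPointedCone) (hne : C.toPointedCone ≠ K.toPointedCone)
    (hK : ¬ IsPolyhedral K.toPointedCone) : distPoly C + 1 ≤ distPoly K := by
  have h1 : ∀ (ℓ : ℕ) (F : Fin (ℓ + 1) → PointedCone ℝ E), IsPolyhedralityChain C F →
      (ℓ : ℕ∞) + 1 ≤ distPoly K := fun ℓ F h => by
    exact_mod_cast (h.snoc hC hne hK).le_distPoly
  have h2 : 1 ≤ distPoly K := by simpa using h1 0 _ (isPolyhedralityChain_lineal C)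
  -- Moving the `+ 1` to the other side lets the supremum be bounded chain by chain.
  rw [← tsub_add_cancel_of_le h2]
  refine add_le_add_left ?_ 1
  exact iSup_le fun ℓ => iSup_le fun F => iSup_le fun h =>
    ENat.le_sub_of_add_le_right ENat.one_ne_top (h1 ℓ F h)

end DistPoly

/-! ### Distance zero as a dual condition -/

section Distance

theorem not_stronglyInfeasible_iff_forall {E : Type*} [NormedAddCommGroup E] {V K : Set E} :
    ¬ StronglyInfeasible V K ↔ ∀ ε : ℝ, 0 < ε → ∃ v ∈ V, ∃ k ∈ K, dist v k < ε := by
  rw [StronglyInfeasible, not_lt, nonpos_iff_eq_zero]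
  constructor
  · intro h ε hε
    have : setDist V K < ENNReal.ofReal ε := by rw [h]; exact ENNReal.ofReal_pos.mpr hε
    simp only [setDist, iInf_lt_iff] at this
    obtain ⟨v, hv, k, hk, hlt⟩ := this
    exact ⟨v, hv, k, hk, edist_lt_ofReal.mp hlt⟩
  · intro h
    refine le_antisymm (ENNReal.le_of_forall_pos_le_add fun ε hε _ => ?_) zero_le
    obtain ⟨v, hv, k, hk, hlt⟩ := h ε (by exact_mod_cast hε)
    rw [zero_add, setDist]
    refine iInf₂_le_of_le v hv (iInf₂_le_of_le k hk ?_)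
    rw [edist_dist]
    exact ENNReal.ofReal_le_of_le_toReal hlt.le

variable {E : Type*} [NormedAddCommGroup E] [InnerProductSpace ℝ E] [FiniteDimensional ℝ E]

/-- The affine space `c + R` has distance zero to the closed cone `K` if and only if `c` is
nonnegative on `K* ∩ Rᗮ`. -/
theorem not_stronglyInfeasible_mk'_iff (c : E) (R : Submodule ℝ E) (K : ProperCone ℝ E) :
    ¬ StronglyInfeasible (AffineSubspace.mk' c R : Set E) (K : Set E) ↔
      ∀ x ∈ innerDual (K : Set E), x ∈ Rᗮ → 0 ≤ inner ℝ c x := by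
  rw [not_stronglyInfeasible_iff_forall]
  constructor
  · intro h x hx hxR
    by_contra! hneg
    -- Since `⟪v, x⟫ = ⟪c, x⟫` and `⟪k, x⟫ ≥ 0`, Cauchy–Schwarz gives `‖v - k‖ * ‖x‖ ≥ -⟪c, x⟫`; the
    -- `+ 1` covers `x = 0`.
    obtain ⟨v, hv, k, hk, hlt⟩ := h (-inner ℝ c x / (‖x‖ + 1))
      (div_pos (neg_pos.mpr hneg) (by positivity))
    have h1 : inner ℝ (v - c) x = 0 :=
      Submodule.inner_right_of_mem_orthogonal (AffineSubspace.mem_mk'.mp hv) hxR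
    have h2 : 0 ≤ inner ℝ k x := hx hk
    have h3 : |inner ℝ (v - k) x| ≤ ‖v - k‖ * ‖x‖ := abs_real_inner_le_norm _ _
    rw [dist_eq_norm, lt_div_iff₀ (by positivity)] at hlt
    rw [inner_sub_left] at h1 h3
    have := neg_abs_le (inner ℝ v x - inner ℝ k x)
    nlinarith [norm_nonneg (v - k)]
  · intro h ε hε
    let M : ProperCone ℝ E :=
      Submodule.closure (PointedCone.ofSubmodule R ⊔ K.toPointedCone : PointedCone ℝ E)
    have hsub : ∀ ρ ∈ R, ∀ k ∈ K, ρ + k ∈ M := fun ρ hρ k hk =>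
      subset_closure (Submodule.add_mem_sup (S := PointedCone.ofSubmodule R) hρ hk)
    have hc : c ∈ M := by
      by_contra hM
      obtain ⟨x, hx, hcx⟩ := M.hyperplane_separation' hM
      refine absurd (h x (fun k hk => hx k ?_) ?_) (not_le.mpr hcx)
      · simpa using hsub 0 R.zero_mem k hk
      · intro ρ hρ
        have h1 := hx ρ (by simpa using hsub ρ hρ 0 K.zero_mem)
        have h2 := hx (-ρ) (by simpa using hsub (-ρ) (R.neg_mem hρ) 0 K.zero_mem)
        rw [inner_neg_left] at h2
        linarith
    obtain ⟨m, hm, hdist⟩ := Metric.mem_closure_iff.mp hc ε hε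
    obtain ⟨ρ, hρ, k, hk, rfl⟩ := Submodule.mem_sup.mp hm
    refine ⟨c - ρ, AffineSubspace.mem_mk'.mpr (by simpa using hρ), k, hk, ?_⟩
    rwa [dist_eq_norm, sub_sub, ← dist_eq_norm]

end Distance

/-! ### Facial reduction -/

section Reduction

/-- The face of a closed cone `C` cut out by the hyperplane orthogonal to `d`. -/
noncomputable def faceOrthogonal {E : Type*} [NormedAddCommGroup E] [InnerProductSpace ℝ E]
    (C : ProperCone ℝ E) (d : E) : ProperCone ℝ E :=
  C ⊓ (⊥ : ProperCone ℝ ℝ).comap (innerSL ℝ d)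

@[simp]
theorem mem_faceOrthogonal {E : Type*} [NormedAddCommGroup E] [InnerProductSpace ℝ E]
    {C : ProperCone ℝ E} {d x : E} :
    x ∈ faceOrthogonal C d ↔ x ∈ C ∧ inner ℝ d x = 0 := Iff.rfl

theorem isFaceOf_faceOrthogonal {E : Type*} [NormedAddCommGroup E] [InnerProductSpace ℝ E]
    {C : ProperCone ℝ E} {d : E} (hd : ∀ x ∈ C, 0 ≤ inner ℝ d x) :
    (faceOrthogonal C d).toPointedCone.IsFaceOf C.toPointedCone := by
  refine .of_mem_of_add_mem_left (fun x hx => hx.1) fun {x y} hx hy hxy => ⟨hx, ?_⟩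
  have h : inner ℝ d (x + y) = 0 := hxy.2
  rw [inner_add_right] at h
  have h' : inner ℝ d x = 0 := le_antisymm (by linarith [hd y hy]) (hd x hx)
  exact h'

theorem reducedFace_cons {E : Type*} [NormedAddCommGroup E] [InnerProductSpace ℝ E]
    {C : ProperCone ℝ E} {d₀ : E} {ℓ : ℕ} (d : Fin ℓ → E) (k : ℕ) :
    reducedFace (C : Set E) (Fin.cons d₀ d : Fin (ℓ + 1) → E) (k + 1) =
      reducedFace (faceOrthogonal C d₀ : Set E) d k := by
  ext x
  simp only [reducedFace, Set.mem_ofPred_eq, Fin.forall_fin_succ, Fin.cons_zero, Fin.cons_succ,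
    Fin.val_zero, Fin.val_succ, Nat.succ_pos, true_imp_iff, add_lt_add_iff_right, SetLike.mem_coe,
    mem_faceOrthogonal, and_assoc]

theorem reducedFace_zero {E : Type*} [NormedAddCommGroup E] [InnerProductSpace ℝ E]
    {C : Set E} {ℓ : ℕ} (d : Fin ℓ → E) : reducedFace C d 0 = C := by
  simp [reducedFace]

variable {r : ℕ} {E : Fin r → Type*} [∀ i, NormedAddCommGroup (E i)]
  [∀ i, InnerProductSpace ℝ (E i)]

/-- A sum of nonnegative terms vanishes only termwise. Hence the reduced cone is again a product,
and the reduction can be iterated factor by factor. -/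
theorem faceOrthogonal_prodCone {C : ∀ i, ProperCone ℝ (E i)} {d : PiLp 2 E}
    (hd : ∀ i, ∀ x ∈ C i, 0 ≤ inner ℝ (d i) x) :
    faceOrthogonal (prodCone C) d = prodCone fun i => faceOrthogonal (C i) (d i) := by
  ext x
  simp only [mem_faceOrthogonal, mem_prodCone, forall_and]
  refine and_congr_right fun hx => ?_
  rw [PiLp.inner_apply, Finset.sum_eq_zero_iff_of_nonneg fun i _ => hd i _ (hx i)]
  simp

variable [∀ i, FiniteDimensional ℝ (E i)]
  {Y : Type*} [NormedAddCommGroup Y] [InnerProductSpace ℝ Y] [FiniteDimensional ℝ Y]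

theorem inner_nonneg_of_mem_innerDual_prodCone {C : ∀ i, ProperCone ℝ (E i)} {d : PiLp 2 E}
    (hd : d ∈ innerDual (prodCone C : Set (PiLp 2 E))) (i : Fin r) (x : E i) (hx : x ∈ C i) :
    0 ≤ inner ℝ (d i) x := by
  rw [innerDual_prodCone] at hd
  rw [real_inner_comm]
  exact mem_prodCone.mp hd i hx

/-- A reducing direction that does not vanish on a nonpolyhedral factor decreases the sum of the
distances to polyhedrality. -/
theorem distPoly_faceOrthogonal_lt {C : ∀ i, ProperCone ℝ (E i)} {d : PiLp 2 E}
    (hd : d ∈ innerDual (prodCone C : Set (PiLp 2 E))) {i : Fin r}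
    (hi : ¬ IsPolyhedral (C i).toPointedCone) {x : E i} (hx : x ∈ C i)
    (hne : inner ℝ (d i) x ≠ 0) :
    ∑ j, distPoly (faceOrthogonal (C j) (d j)) < ∑ j, distPoly (C j) := by
  have hface := fun j => isFaceOf_faceOrthogonal (inner_nonneg_of_mem_innerDual_prodCone hd j)
  have hle : ∑ j, distPoly (faceOrthogonal (C j) (d j)) + 1 ≤ ∑ j, distPoly (C j) := by
    rw [← Finset.add_sum_erase _ _ (Finset.mem_univ i),
      ← Finset.add_sum_erase _ (fun j => distPoly (C j)) (Finset.mem_univ i), add_right_comm]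
    refine add_le_add (distPoly_add_one_le (hface i) (fun e => hne ?_) hi)
      (Finset.sum_le_sum fun j _ => distPoly_mono (hface j))
    have : x ∈ (faceOrthogonal (C i) (d i)).toPointedCone := by rw [e]; exact hx
    exact this.2
  refine (ENat.add_one_le_iff ?_).mp hle
  exact WithTop.sum_ne_top.mpr fun j _ => distPoly_ne_top _

/-- Facial reduction: at most `∑ i, distPoly (C i)` reducing directions lead to a face whose
dual cone has a closed sum with `range Aᵀ`. -/
theorem exists_isReducingSequence (A : PiLp 2 E →ₗ[ℝ] Y) (n : ℕ) (C : ∀ i, ProperCone ℝ (E i))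
    (hn : ∑ i, distPoly (C i) ≤ n) :
    ∃ (ℓ : ℕ) (d : Fin ℓ → PiLp 2 E) (F : ProperCone ℝ (PiLp 2 E)), ℓ ≤ n ∧
      IsReducingSequence A (prodCone C : Set (PiLp 2 E)) d ∧
      (F : Set (PiLp 2 E)) = reducedFace (prodCone C : Set (PiLp 2 E)) d ℓ ∧
      IsClosed ((PointedCone.ofSubmodule (LinearMap.range A.adjoint) ⊔
        (innerDual (F : Set (PiLp 2 E))).toPointedCone : PointedCone ℝ (PiLp 2 E)) :
          Set (PiLp 2 E)) := by
  classical
  induction n generalizing C with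
  | zero =>
    refine ⟨0, Fin.elim0, prodCone C, le_rfl, fun i => i.elim0, (reducedFace_zero _).symm,
      isClosed_sup_innerDual_prodCone _ C fun d hdR hd i hi x hx => ?_⟩
    -- The sum of distances is already zero and cannot drop further.
    by_contra hne
    have := (distPoly_faceOrthogonal_lt hd hi hx hne).trans_le hn
    simp at this
  | succ n ih =>
    by_cases hclosed : ∀ d ∈ LinearMap.range A.adjoint,
        d ∈ innerDual (prodCone C : Set (PiLp 2 E)) →
        ∀ i, ¬ IsPolyhedral (C i).toPointedCone → ∀ x ∈ C i, inner ℝ (d i) x = 0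
    · exact ⟨0, Fin.elim0, prodCone C, Nat.zero_le _, fun i => i.elim0, (reducedFace_zero _).symm,
        isClosed_sup_innerDual_prodCone _ C hclosed⟩
    push Not at hclosed
    obtain ⟨d₀, hdR, hd₀, i, hi, x, hx, hne⟩ := hclosed
    have hlt := (distPoly_faceOrthogonal_lt hd₀ hi hx hne).trans_le hn
    obtain ⟨ℓ, d, F, hℓ, hd, hF, hFcl⟩ := ih (fun j => faceOrthogonal (C j) (d₀ j))
      (Order.le_of_lt_add_one (by exact_mod_cast hlt))
    rw [← faceOrthogonal_prodCone (inner_nonneg_of_mem_innerDual_prodCone hd₀)] at hd hF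
    refine ⟨ℓ + 1, Fin.cons d₀ d, F, Nat.succ_le_succ hℓ, ?_, ?_, hFcl⟩
    · refine Fin.cases ⟨hdR, ?_⟩ fun j => ?_
      · rw [Fin.val_zero, reducedFace_zero]
        exact hd₀
      · rw [Fin.val_succ, reducedFace_cons, Fin.cons_succ]
        exact hd j
    · rw [reducedFace_cons, hF]

end Reduction

/-! ### Values of the homogeneous problem and strong duality -/

section Duality

variable {E Y : Type*} [NormedAddCommGroup E] [InnerProductSpace ℝ E]
  [NormedAddCommGroup Y] [InnerProductSpace ℝ Y] {A : E →ₗ[ℝ] Y} {c : E}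

theorem primalValue_eq_zero {C : ProperCone ℝ E} (h : ∀ x ∈ C, A x = 0 → 0 ≤ inner ℝ c x) :
    primalValue A 0 c (C : Set E) = 0 := by
  refine le_antisymm ?_ (le_iInf₂ fun x hx => by exact_mod_cast h x hx.2 hx.1)
  exact iInf₂_le_of_le 0 ⟨map_zero A, C.zero_mem⟩ (by simp)

theorem primalValue_eq_bot {C : ProperCone ℝ E} {x : E} (hx : x ∈ C) (hA : A x = 0)
    (hc : inner ℝ c x < 0) : primalValue A 0 c (C : Set E) = ⊥ := by
  refine (EReal.eq_bot_iff_forall_lt _).mpr fun M => ?_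
  obtain ⟨t, ht0, ht⟩ : ∃ t : ℝ, 0 ≤ t ∧ t * inner ℝ c x < M := by
    -- This scaling makes the objective equal to `-(|M| + 1)`, which is below `M`.
    refine ⟨(|M| + 1) / -inner ℝ c x, div_nonneg (by positivity) (by linarith), ?_⟩
    rw [div_neg, neg_mul, div_mul_cancel₀ _ hc.ne]
    linarith [neg_abs_le M]
  refine lt_of_le_of_lt (iInf₂_le (t • x) ⟨by simp [hA], C.smul_mem hx ht0⟩) ?_
  rw [inner_smul_right]
  exact_mod_cast ht

variable [FiniteDimensional ℝ E] [FiniteDimensional ℝ Y]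

theorem dualValue_zero_eq_zero {C : Set E} (h : ∃ y, c - A.adjoint y ∈ C) :
    dualValue A 0 c C = 0 := by
  obtain ⟨y, hy⟩ := h
  exact le_antisymm (iSup₂_le fun y _ => by simp) (le_iSup₂_of_le y hy (by simp))

theorem dualValue_eq_bot {b : Y} {C : Set E} (h : ¬ ∃ y, c - A.adjoint y ∈ C) :
    dualValue A b c C = ⊥ :=
  eq_bot_iff.mpr (iSup₂_le fun y hy => absurd ⟨y, hy⟩ h)

/-- If the dual of a reduced problem is feasible, then `c` is nonnegative on the feasible set of
the unreduced problem. -/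
theorem IsReducingSequence.inner_nonneg {C : Set E} {ℓ : ℕ} {d : Fin ℓ → E}
    (hd : IsReducingSequence A C d) {y : Y}
    (hy : c - A.adjoint y ∈ innerDual (reducedFace C d ℓ)) {x : E} (hx : x ∈ C) (hA : A x = 0) :
    0 ≤ inner ℝ c x := by
  -- Reducing directions lie in `range Aᵀ`, so they are orthogonal to `ker A`: no feasible point is
  -- lost.
  have hxF : x ∈ reducedFace C d ℓ := ⟨hx, fun j _ => by
    obtain ⟨z, hz⟩ := (hd j).1
    rw [← hz, LinearMap.adjoint_inner_left, hA, inner_zero_right]⟩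
  have := hy hxF
  rwa [innerₗ_apply_apply, inner_sub_right, LinearMap.adjoint_inner_right, hA, inner_zero_left,
    sub_zero, real_inner_comm] at this

variable {K : ProperCone ℝ E}

/-- Both values are `0` or `-∞`, and a feasible reduced dual forces the primal value to be `0`.
Attainment is free, the dual objective being zero. -/
theorem restoresStrongDuality_iff {ℓ : ℕ} {d : Fin ℓ → E}
    (hd : IsReducingSequence A (innerDual (K : Set E) : Set E) d) :
    RestoresStrongDuality A c K d ↔
      ((∀ x ∈ innerDual (K : Set E), A x = 0 → 0 ≤ inner ℝ c x) →
        ∃ y, c - A.adjoint y ∈ reducedDualCone K d) := by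
  constructor
  · intro h hc
    by_contra hy
    have := h.value_eq
    rw [primalValue_eq_zero hc, dualValue_eq_bot hy] at this
    exact EReal.zero_ne_bot this
  · intro h
    by_cases hc : ∀ x ∈ innerDual (K : Set E), A x = 0 → 0 ≤ inner ℝ c x
    · have hy : ∃ y, c - A.adjoint y ∈ (reducedDualCone K d : Set E) := h hc
      refine ⟨hd, by rw [primalValue_eq_zero hc, dualValue_zero_eq_zero hy], fun _ _ => ?_⟩
      obtain ⟨y, hy'⟩ := hy
      exact ⟨y, hy', by rw [dualValue_zero_eq_zero ⟨y, hy'⟩]; simp⟩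
    · have hc' := hc
      push Not at hc'
      obtain ⟨x, hx, hA, hneg⟩ := hc'
      have hbot := primalValue_eq_bot hx hA hneg
      refine ⟨hd, ?_, fun h => absurd hbot h.ne'⟩
      rw [hbot, dualValue_eq_bot]
      rintro ⟨y, hy⟩
      exact hc fun x hx hA => hd.inner_nonneg hy hx hA

theorem RestoresStrongDuality.distStrong_le {ℓ : ℕ} {d : Fin ℓ → E}
    (hd : RestoresStrongDuality A c K d) : distStrong A c K ≤ ℓ :=
  iInf_le_of_le ℓ (iInf_le_of_le d (iInf_le_of_le hd le_rfl))

theorem exists_eq_distStrong {ℓ : ℕ} {d : Fin ℓ → E} (hd : RestoresStrongDuality A c K d) :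
    ∃ (k : ℕ) (e : Fin k → E), RestoresStrongDuality A c K e ∧ (k : ℕ∞) = distStrong A c K := by
  classical
  have hex : ∃ k, ∃ e : Fin k → E, RestoresStrongDuality A c K e := ⟨ℓ, d, hd⟩
  obtain ⟨e, he⟩ := Nat.find_spec hex
  refine ⟨Nat.find hex, e, he, le_antisymm ?_ he.distStrong_le⟩
  refine le_iInf fun k => le_iInf fun e => le_iInf fun he => ?_
  exact_mod_cast Nat.find_min' hex ⟨e, he⟩

theorem mem_orthogonal_range_adjoint {x : E} : x ∈ (LinearMap.range A.adjoint)ᗮ ↔ A x = 0 := by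
  rw [LinearMap.orthogonal_range, LinearMap.adjoint_adjoint, LinearMap.mem_ker]

theorem not_stronglyInfeasible_slackSpace_iff :
    ¬ StronglyInfeasible (slackSpace A c : Set E) (K : Set E) ↔
      ∀ x ∈ innerDual (K : Set E), A x = 0 → 0 ≤ inner ℝ c x := by
  rw [slackSpace, not_stronglyInfeasible_mk'_iff]
  simp only [mem_orthogonal_range_adjoint]

/-- The affine space through a slack that is feasible for the dual of the reduced problem, spanned
by the reducing directions, has distance zero to `K`. -/
theorem not_stronglyInfeasible_mk'_span_range {ℓ : ℕ} {d : Fin ℓ → E} {s : E}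
    (hs : s ∈ reducedDualCone K d) :
    ¬ StronglyInfeasible (AffineSubspace.mk' s (Submodule.span ℝ (Set.range d)) : Set E)
      (K : Set E) := by
  rw [not_stronglyInfeasible_mk'_iff]
  intro x hx hxd
  rw [real_inner_comm]
  exact hs ⟨hx, fun j _ => hxd _ (Submodule.subset_span ⟨j, rfl⟩)⟩

end Duality

/-- Facial reduction is run until the sum with `range Aᵀ` is closed; Farkas' lemma on the final face
then gives the dual feasible point. -/
theorem exists_restoresStrongDuality {r : ℕ} {E : Fin r → Type*} [∀ i, NormedAddCommGroup (E i)]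
    [∀ i, InnerProductSpace ℝ (E i)] [∀ i, FiniteDimensional ℝ (E i)]
    {Y : Type*} [NormedAddCommGroup Y] [InnerProductSpace ℝ Y] [FiniteDimensional ℝ Y]
    (K : ∀ i, ProperCone ℝ (E i)) (A : PiLp 2 E →ₗ[ℝ] Y) (c : PiLp 2 E) :
    ∃ (ℓ : ℕ) (d : Fin ℓ → PiLp 2 E), RestoresStrongDuality A c (prodCone K) d ∧
      (ℓ : ℕ∞) ≤ ∑ i, distPoly (innerDual (K i : Set (E i))) := by
  obtain ⟨n, hn⟩ : ∃ n : ℕ, (n : ℕ∞) = ∑ i, distPoly (innerDual (K i : Set (E i))) :=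
    ENat.ne_top_iff_exists.mp (WithTop.sum_ne_top.mpr fun i _ => distPoly_ne_top _)
  obtain ⟨ℓ, d, F, hℓ, hd, hF, hcl⟩ := exists_isReducingSequence A n _ hn.ge
  rw [← innerDual_prodCone] at hd hF
  refine ⟨ℓ, d, (restoresStrongDuality_iff hd).mpr fun h => ?_, hn ▸ by exact_mod_cast hℓ⟩
  rw [reducedDualCone, ← hF]
  refine exists_sub_adjoint_mem_innerDual A F c hcl fun x hx hA => h x ?_ hA
  have hx : x ∈ (F : Set (PiLp 2 E)) := hx
  rw [hF] at hx
  exact hx.1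

end ConicLP

theorem mainTheorem6 {r : ℕ} {E : Fin r → Type*} [∀ i, NormedAddCommGroup (E i)]
    [∀ i, InnerProductSpace ℝ (E i)] [∀ i, FiniteDimensional ℝ (E i)]
    {Y : Type*} [NormedAddCommGroup Y] [InnerProductSpace ℝ Y] [FiniteDimensional ℝ Y]
    (K : ∀ i, ProperCone ℝ (E i)) (A : PiLp 2 E →ₗ[ℝ] Y) (c : PiLp 2 E) :
    (¬ ConicLP.StronglyInfeasible (ConicLP.slackSpace A c : Set (PiLp 2 E))
          (ConicLP.prodCone K : Set (PiLp 2 E)) ↔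
      ∃ (ℓ : ℕ) (d : Fin ℓ → PiLp 2 E),
        ConicLP.RestoresStrongDuality A c (ConicLP.prodCone K) d ∧
        (ℓ : ℕ∞) = ConicLP.distStrong A c (ConicLP.prodCone K) ∧
        ∃ y : Y, c - A.adjoint y ∈ ConicLP.reducedDualCone (ConicLP.prodCone K) d) ∧
    (¬ ConicLP.StronglyInfeasible (ConicLP.slackSpace A c : Set (PiLp 2 E))
          (ConicLP.prodCone K : Set (PiLp 2 E)) →
      ∃ V' : AffineSubspace ℝ (PiLp 2 E),
        V' ≤ ConicLP.slackSpace A c ∧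
        ¬ ConicLP.StronglyInfeasible (V' : Set (PiLp 2 E))
          (ConicLP.prodCone K : Set (PiLp 2 E)) ∧
        (Module.finrank ℝ V'.direction : ℕ∞) ≤ ConicLP.distStrong A c (ConicLP.prodCone K) ∧
        ConicLP.distStrong A c (ConicLP.prodCone K) ≤
          ∑ i, ConicLP.distPoly (ProperCone.innerDual (K i : Set (E i))) ∧
        (ConicLP.WeaklyInfeasible (ConicLP.slackSpace A c : Set (PiLp 2 E))
            (ConicLP.prodCone K : Set (PiLp 2 E)) →
          ConicLP.WeaklyInfeasible (V' : Set (PiLp 2 E))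
            (ConicLP.prodCone K : Set (PiLp 2 E)))) := by
  obtain ⟨ℓ₀, d₀, hd₀, hℓ₀⟩ := ConicLP.exists_restoresStrongDuality K A c
  obtain ⟨ℓ, d, hd, hℓ⟩ := ConicLP.exists_eq_distStrong hd₀
  have hfeas : ¬ ConicLP.StronglyInfeasible (ConicLP.slackSpace A c : Set (PiLp 2 E))
      (ConicLP.prodCone K : Set (PiLp 2 E)) →
      ∃ y : Y, c - A.adjoint y ∈ ConicLP.reducedDualCone (ConicLP.prodCone K) d := fun h =>
    (ConicLP.restoresStrongDuality_iff hd.reducing).mp hd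
      (ConicLP.not_stronglyInfeasible_slackSpace_iff.mp h)
  refine ⟨⟨fun h => ⟨ℓ, d, hd, hℓ, hfeas h⟩, ?_⟩, fun h => ?_⟩
  -- Minimality of `ℓ` plays no role here: a feasible reduced dual for any reducing sequence makes
  -- `c` nonnegative on `K* ∩ ker A`.
  · rintro ⟨ℓ, d, hd, -, y, hy⟩
    exact ConicLP.not_stronglyInfeasible_slackSpace_iff.mpr fun x hx hA =>
      hd.reducing.inner_nonneg hy hx hA
  · obtain ⟨y, hy⟩ := hfeas h
    have hle : AffineSubspace.mk' (c - A.adjoint y) (Submodule.span ℝ (Set.range d)) ≤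
        ConicLP.slackSpace A c := by
      intro v hv
      have h1 : v - (c - A.adjoint y) ∈ LinearMap.range A.adjoint :=
        Submodule.span_le.mpr (Set.range_subset_iff.mpr fun j => (hd.reducing j).1)
          (AffineSubspace.mem_mk'.mp hv)
      refine AffineSubspace.mem_mk'.mpr ?_
      have h2 := Submodule.sub_mem _ h1 (LinearMap.mem_range_self A.adjoint y)
      rwa [sub_sub, sub_add_cancel] at h2
    have hV' := ConicLP.not_stronglyInfeasible_mk'_span_range hy
    refine ⟨_, hle, hV', ?_, ?_, fun hw => ⟨?_, ?_⟩⟩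
    · rw [AffineSubspace.direction_mk', ← hℓ]
      exact_mod_cast (finrank_range_le_card d).trans (Fintype.card_fin ℓ).le
    · exact hd₀.distStrong_le.trans hℓ₀
    -- Passing to a subspace keeps the intersection with `K` empty; only distance zero had to be
    -- preserved.
    · exact Set.subset_eq_empty (Set.inter_subset_inter_left _ hle) hw.1
    · exact nonpos_iff_eq_zero.mp (not_lt.mp hV')
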